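/- Let $D\ge 1$ and let $X_1,\dots,X_D$ be geodesic $\delta$-hyperbolic metric spaces, with Gromov boundaries $\partial X_i$. Let $\mathbb X=\prod_{i=1}^D X_i$ with the $\ell^\infty$ product metric, let $\partial_{reg}\mathbb X=\prod_{i=1}^D\partial X_i$, and let $\mathrm{Aut}\,\mathbb X$ be the group of isometries of $\mathbb X$ generated by $\prod_{i=1}^D\mathrm{Isom}\,X_i$ and the permutations of isometric factors, i.e. the group of all maps $(x_j)_j\mapsto(\varphi_j(x_{\sigma(j)}))_j$ with $\sigma$ a permutation of $\{1,\dots,D\}$ and $\varphi_j\colon X_{\sigma(j)}\to X_j$ surjective isometries; it acts on $\partial_{reg}\mathbb X$ by the same formula. Let $\Gamma$ be a group and $\Gamma\to\mathrm{Aut}\,\mathbb X$ a homomorphism which is AU-acylindrical (acylindrical of ambiguous uniformity): for every $\epsilon>0$ there is $R\ge 0$ such that for all $x,y\in\mathbb X$ with $d(x,y)\ge R$ the set $\{g\in\Gamma : d(gx,x)\le\epsilon \text{ and } d(gy,y)\le\epsilon\}$ is finite. Let $\xi^-,\xi^+\in\partial_{reg}\mathbb X$ have distinct factors, i.e. $\xi^-_i\ne\xi^+_i$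 for every $i\in\{1,\dots,D\}$. Then there is an integer $k$ with $0\le k\le D$ such that the stabilizer $$E_\Gamma(\xi^\pm)=\mathrm{Stab}_\Gamma\{\xi^-,\xi^+\}=\{g\in\Gamma : g\{\xi^-,\xi^+\}=\{\xi^-,\xi^+\}\}$$ is virtually isomorphic to $\mathbb Z^k$. Here groups $G$ and $H$ are virtually isomorphic if there are finite index subgroups $G'\le G$, $H'\le H$ and finite normal subgroups $K\trianglelefteq G'$, $L\trianglelefteq H'$ such that $G'/K\cong H'/L$. -/

import Mathlib

open Filter
open scoped Pointwise

namespace HypProd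

universe u v

noncomputable section

/-! ### Geodesic hyperbolic spaces -/

/-- The Gromov product `⟨x, y⟩_o`. -/
def gromovProduct {X : Type u} [MetricSpace X] (x y o : X) : ℝ :=
  (dist x o + dist o y - dist x y) / 2

/-- `γ`, restricted to `[0, dist a b]`, is a geodesic segment from `a` to `b`. -/
def IsGeodesicSegment {X : Type u} [MetricSpace X] (γ : ℝ → X) (a b : X) : Prop :=
  γ 0 = a ∧ γ (dist a b) = b ∧
    ∀ s ∈ Set.Icc 0 (dist a b), ∀ t ∈ Set.Icc 0 (dist a b), dist (γ s) (γ t) = |s - t|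

/-- Any two points are joined by a geodesic segment. -/
def IsGeodesicSpace (X : Type u) [MetricSpace X] : Prop :=
  ∀ a b : X, ∃ γ : ℝ → X, IsGeodesicSegment γ a b

/-- Geodesic triangles are `δ`-thin: for the projection of a geodesic triangle with vertices
`a, b, c` to its comparison tripod, all fibres have diameter at most `δ`.
The leg of the tripod at the vertex `a` has length `⟨b, c⟩_a`, and two points on different sides
of the triangle have the same image iff, for the vertex `a` common to the two sides, they are at
the same distance `t ≤ ⟨b, c⟩_a` from `a` (the centre of the tripod being the case
`t = ⟨b, c⟩_a`). All the vertices are covered since `a, b, c` are arbitrary. -/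
def HasThinTriangles (δ : ℝ) (X : Type u) [MetricSpace X] : Prop :=
  ∀ (a b c : X) (γ γ' : ℝ → X), IsGeodesicSegment γ a b → IsGeodesicSegment γ' a c →
    ∀ t : ℝ, 0 ≤ t → t ≤ gromovProduct b c a → dist (γ t) (γ' t) ≤ δ

/-- `X` is a `δ`-hyperbolic geodesic space. -/
def IsHyperbolic (δ : ℝ) (X : Type u) [MetricSpace X] : Prop :=
  IsGeodesicSpace X ∧ HasThinTriangles δ X

/-! ### The Gromov boundary -/

/-- The Gromov products `⟨x(n), y(m)⟩_o` tend to infinity as `n, m → ∞` (for every base point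
`o`, equivalently for one base point). -/
def GromovConv {X : Type u} [MetricSpace X] (x y : ℕ → X) : Prop :=
  ∀ o : X, Tendsto (fun p : ℕ × ℕ => gromovProduct (x p.1) (y p.2) o) atTop atTop

/-- Gromov sequences in `X`. -/
def GromovSeq (X : Type u) [MetricSpace X] : Type u :=
  {x : ℕ → X // GromovConv x x}

/-- Equivalence of Gromov sequences. -/
def GromovSeq.Equivalent {X : Type u} [MetricSpace X] (x y : GromovSeq X) : Prop :=
  GromovConv x.1 y.1

/-- The Gromov boundary: Gromov sequences up to equivalence. On a hyperbolic space equivalence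
is an equivalence relation, see `GromovBoundary.mk_eq_mk_iff`. -/
def GromovBoundary (X : Type u) [MetricSpace X] : Type u :=
  Quot (GromovSeq.Equivalent (X := X))

theorem gromovProduct_comm {X : Type u} [MetricSpace X] (x y o : X) :
    gromovProduct x y o = gromovProduct y x o := by
  unfold gromovProduct
  rw [dist_comm x y, dist_comm x o, dist_comm o y]
  ring

theorem gromovProduct_le_left {X : Type u} [MetricSpace X] (x y o : X) :
    gromovProduct x y o ≤ dist o x := by
  have := dist_triangle o x y
  have := dist_comm x o
  unfold gromovProduct
  linarith

theorem gromovProduct_nonneg {X : Type u} [MetricSpace X] (x y o : X) :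
    0 ≤ gromovProduct x y o := by
  have := dist_triangle x o y
  unfold gromovProduct
  linarith

/-- The four-point inequality in a hyperbolic geodesic space. -/
theorem IsHyperbolic.four_point {X : Type u} [MetricSpace X] {δ : ℝ} (h : IsHyperbolic δ X)
    (x y z o : X) :
    min (gromovProduct x y o) (gromovProduct y z o) - δ ≤ gromovProduct x z o := by
  obtain ⟨γx, hx⟩ := h.1 o x
  obtain ⟨γy, hy⟩ := h.1 o y
  obtain ⟨γz, hz⟩ := h.1 o z
  set t := min (gromovProduct x y o) (gromovProduct y z o) with ht
  have t0 : 0 ≤ t := le_min (gromovProduct_nonneg _ _ _) (gromovProduct_nonneg _ _ _)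
  have t1 : t ≤ gromovProduct x y o := min_le_left _ _
  have t2 : t ≤ gromovProduct y z o := min_le_right _ _
  have tx : t ≤ dist o x := t1.trans (gromovProduct_le_left _ _ _)
  have tz : t ≤ dist o z := by
    rw [gromovProduct_comm] at t2
    exact t2.trans (gromovProduct_le_left _ _ _)
  have h1 := h.2 o x y γx γy hx hy t t0 t1
  have h2 := h.2 o y z γy γz hy hz t t0 t2
  have e1 := hx.2.2 (dist o x) ⟨dist_nonneg, le_rfl⟩ t ⟨t0, tx⟩
  have e2 := hz.2.2 t ⟨t0, tz⟩ (dist o z) ⟨dist_nonneg, le_rfl⟩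
  rw [hx.2.1, abs_of_nonneg (by linarith)] at e1
  rw [hz.2.1, abs_of_nonpos (by linarith)] at e2
  have := dist_triangle4 x (γx t) (γz t) z
  have := dist_triangle (γx t) (γy t) (γz t)
  have := dist_comm x o
  unfold gromovProduct
  linarith

theorem gromovConv_iff {X : Type u} [MetricSpace X] {x y : ℕ → X} :
    GromovConv x y ↔ ∀ (o : X) (C : ℝ), ∃ N : ℕ, ∀ n ≥ N, ∀ m ≥ N,
      C ≤ gromovProduct (x n) (y m) o := by
  unfold GromovConv
  refine forall_congr' fun o => ?_
  rw [tendsto_atTop_atTop]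
  refine forall_congr' fun C => ⟨?_, ?_⟩
  · rintro ⟨⟨a, b⟩, hab⟩
    exact ⟨max a b, fun n hn m hm =>
      hab (n, m) ⟨(le_max_left _ _).trans hn, (le_max_right _ _).trans hm⟩⟩
  · rintro ⟨N, hN⟩
    exact ⟨(N, N), fun p hp => hN p.1 hp.1 p.2 hp.2⟩

theorem GromovSeq.Equivalent.equivalence {X : Type u} [MetricSpace X] {δ : ℝ}
    (h : IsHyperbolic δ X) : Equivalence (GromovSeq.Equivalent (X := X)) where
  refl x := x.2
  symm := by
    intro x y hxy
    refine gromovConv_iff.2 fun o C => ?_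
    obtain ⟨N, hN⟩ := gromovConv_iff.1 hxy o C
    refine ⟨N, fun n hn m hm => ?_⟩
    rw [gromovProduct_comm]
    exact hN m hm n hn
  trans := by
    intro x y z hxy hyz
    refine gromovConv_iff.2 fun o C => ?_
    obtain ⟨N, hN⟩ := gromovConv_iff.1 hxy o (C + δ)
    obtain ⟨M, hM⟩ := gromovConv_iff.1 hyz o (C + δ)
    refine ⟨max N M, fun n hn m hm => ?_⟩
    have h1 := hN n ((le_max_left _ _).trans hn) (max N M) (le_max_left _ _)
    have h2 := hM (max N M) (le_max_right _ _) m ((le_max_right _ _).trans hm)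
    have := h.four_point (x.1 n) (y.1 (max N M)) (z.1 m) o
    have := le_min h1 h2
    linarith

/-- In a hyperbolic space, two Gromov sequences define the same boundary point iff they are
equivalent. -/
theorem GromovBoundary.mk_eq_mk_iff {X : Type u} [MetricSpace X] {δ : ℝ}
    (h : IsHyperbolic δ X) (x y : GromovSeq X) :
    (Quot.mk _ x : GromovBoundary X) = Quot.mk _ y ↔ x.Equivalent y :=
  (GromovSeq.Equivalent.equivalence h).quot_mk_eq_iff x y

theorem GromovConv.map {X Y : Type u} [MetricSpace X] [MetricSpace Y] (e : X ≃ᵢ Y)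
    {x y : ℕ → X} (h : GromovConv x y) :
    GromovConv (fun n => e (x n)) (fun n => e (y n)) := by
  intro o
  have := h (e.symm o)
  refine this.congr fun p => ?_
  unfold gromovProduct
  rw [← e.dist_eq (x p.1) (e.symm o), ← e.dist_eq (e.symm o), ← e.dist_eq (x p.1) (y p.2),
    e.apply_symm_apply]

/-- The image of a Gromov sequence under an isometry. -/
def GromovSeq.map {X Y : Type u} [MetricSpace X] [MetricSpace Y] (e : X ≃ᵢ Y)
    (x : GromovSeq X) : GromovSeq Y :=
  ⟨fun n => e (x.1 n), x.2.map e⟩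

/-- The map of Gromov boundaries induced by an isometry. -/
def GromovBoundary.map {X Y : Type u} [MetricSpace X] [MetricSpace Y] (e : X ≃ᵢ Y) :
    GromovBoundary X → GromovBoundary Y :=
  Quot.map (GromovSeq.map e) fun _ _ h => GromovConv.map e h

/-! ### Automorphisms of a product -/

/-- The isometry `X i ≃ᵢ X j` given by an equality of indices. -/
def castIso {D : ℕ} (X : Fin D → Type u) [∀ i, MetricSpace (X i)] {i j : Fin D} (h : i = j) :
    X i ≃ᵢ X j := by
  subst h
  exact IsometryEquiv.refl _

theorem castIso_heq {D : ℕ} (X : Fin D → Type u) [∀ i, MetricSpace (X i)] {i j : Fin D}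
    (h : i = j) : HEq (castIso X h) (IsometryEquiv.refl (X j)) := by
  subst h
  rfl

/-- `Aut 𝕏` for `𝕏 = ∏ X_i`: a permutation of the indices (only matching isometric factors)
together with isometries between the matched factors. An element `g` acts on `𝕏` by
`(g x)_j = g.iso j (x_{g.perm j})`. -/
structure ProdAut {D : ℕ} (X : Fin D → Type u) [∀ i, MetricSpace (X i)] where
  /-- the factor `X (perm j)` is carried to the factor `X j` -/
  perm : Equiv.Perm (Fin D)
  /-- the isometry from the factor `X (perm j)` onto the factor `X j` -/
  iso : ∀ j, X (perm j) ≃ᵢ X j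

namespace ProdAut

variable {D : ℕ} {X : Fin D → Type u} [∀ i, MetricSpace (X i)]

theorem ext_heq {g h : ProdAut X} (h1 : g.perm = h.perm) (h2 : ∀ j, HEq (g.iso j) (h.iso j)) :
    g = h := by
  obtain ⟨σ, φ⟩ := g
  obtain ⟨τ, ψ⟩ := h
  obtain rfl : σ = τ := h1
  obtain rfl : φ = ψ := funext fun j => eq_of_heq (h2 j)
  rfl

instance : One (ProdAut X) := ⟨⟨1, fun j => IsometryEquiv.refl (X j)⟩⟩

/-- Composition of the actions on `∏ X_i`: first `h`, then `g`. -/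
instance : Mul (ProdAut X) :=
  ⟨fun g h => ⟨g.perm.trans h.perm, fun j => (h.iso (g.perm j)).trans (g.iso j)⟩⟩

instance : Inv (ProdAut X) :=
  ⟨fun g => ⟨g.perm.symm, fun j =>
    (g.iso (g.perm.symm j)).symm.trans (castIso X (g.perm.apply_symm_apply j))⟩⟩

instance : Group (ProdAut X) :=
  Group.ofLeftAxioms (fun _ _ _ => rfl) (fun _ => rfl) (by
    intro g
    refine ext_heq (Equiv.symm_trans_self g.perm) fun j => ?_
    refine HEq.trans (heq_of_eq ?_) (castIso_heq X (g.perm.apply_symm_apply j))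
    ext x
    exact congrArg (castIso X (g.perm.apply_symm_apply j))
      ((g.iso (g.perm.symm j)).symm_apply_apply x))

/-- The action of `Aut 𝕏` on the product `𝕏 = ∏ X_i`. -/
instance : MulAction (ProdAut X) (∀ i, X i) where
  smul g x := fun j => g.iso j (x (g.perm j))
  one_smul _ := rfl
  mul_smul _ _ _ := rfl

end ProdAut

/-- The regular boundary `∂_reg 𝕏 = ∏ ∂X_i`. -/
def RegBoundary {D : ℕ} (X : Fin D → Type u) [∀ i, MetricSpace (X i)] : Type u :=
  ∀ i, GromovBoundary (X i)

/-- The action of `Aut 𝕏` on the regular boundary: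
`(g ξ)_j = g.iso j (ξ_{g.perm j})`. -/
instance {D : ℕ} (X : Fin D → Type u) [∀ i, MetricSpace (X i)] :
    MulAction (ProdAut X) (RegBoundary X) where
  smul g ξ := fun j => GromovBoundary.map (g.iso j) (ξ (g.perm j))
  one_smul ξ := by
    funext j
    change GromovBoundary.map (IsometryEquiv.refl (X j)) (ξ j) = ξ j
    induction ξ j using Quot.ind with
    | mk x => rfl
  mul_smul g h ξ := by
    funext j
    change GromovBoundary.map ((h.iso (g.perm j)).trans (g.iso j)) (ξ (h.perm (g.perm j))) =
      GromovBoundary.map (g.iso j)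
        (GromovBoundary.map (h.iso (g.perm j)) (ξ (h.perm (g.perm j))))
    induction ξ (h.perm (g.perm j)) using Quot.ind with
    | mk x => rfl

/-! ### AU-acylindrical actions -/

/-- `Aut 𝕏` acts on `𝕏` by isometries, for the `ℓ^∞` product metric (the metric of
`∀ i, X i`). -/
instance {D : ℕ} (X : Fin D → Type u) [∀ i, MetricSpace (X i)] :
    IsIsometricSMul (ProdAut X) (∀ i, X i) where
  isometry_smul g := by
    refine Isometry.of_dist_eq fun x y => ?_
    have key : ∀ r : ℝ, 0 ≤ r → (dist (g • x) (g • y) ≤ r ↔ dist x y ≤ r) := by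
      intro r hr
      rw [dist_pi_le_iff hr, dist_pi_le_iff hr]
      constructor
      · intro h i
        have := h (g.perm.symm i)
        change dist (g.iso _ (x (g.perm _))) (g.iso _ (y (g.perm _))) ≤ r at this
        rwa [IsometryEquiv.dist_eq, Equiv.apply_symm_apply] at this
      · intro h j
        change dist (g.iso _ (x (g.perm _))) (g.iso _ (y (g.perm _))) ≤ r
        rw [IsometryEquiv.dist_eq]
        exact h _
    exact le_antisymm ((key _ dist_nonneg).2 le_rfl) ((key _ dist_nonneg).1 le_rfl)

/-- The homomorphism from a group acting by isometries to the isometry group. -/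
def toIsom (G : Type v) (Y : Type u) [Group G] [MetricSpace Y] [MulAction G Y]
    [IsIsometricSMul G Y] : G →* (Y ≃ᵢ Y) where
  toFun g := IsometryEquiv.constSMul g
  map_one' := by
    ext y
    exact one_smul G y
  map_mul' g h := by
    ext y
    exact mul_smul g h y

/-- The `ε`-coarse stabilizer of a set `S`. -/
def coarseStab {Γ : Type v} {Y : Type u} [Group Γ] [MetricSpace Y] (ρ : Γ →* (Y ≃ᵢ Y))
    (ε : ℝ) (S : Set Y) : Set Γ :=
  {g | ∀ x ∈ S, dist (ρ g x) x ≤ ε}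

/-- AU-acylindrical isometric actions (acylindrical of ambiguous uniformity). -/
def IsAUAcylindrical {Γ : Type v} {Y : Type u} [Group Γ] [MetricSpace Y]
    (ρ : Γ →* (Y ≃ᵢ Y)) : Prop :=
  ∀ ε : ℝ, 0 < ε → ∃ R : ℝ, 0 ≤ R ∧
    ∀ x y : Y, R ≤ dist x y → (coarseStab ρ ε {x, y}).Finite

/-! ### Virtual isomorphism -/

/-- `G` and `H` are virtually isomorphic: after passing to finite index subgroups and dividing
these by finite normal subgroups, they become isomorphic. -/
def VirtuallyIsomorphic (G : Type u) (H : Type v) [Group G] [Group H] : Prop :=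
  ∃ (G' : Subgroup G) (H' : Subgroup H), G'.FiniteIndex ∧ H'.FiniteIndex ∧
    ∃ (K : Subgroup G') (L : Subgroup H') (_ : K.Normal) (_ : L.Normal),
      Finite K ∧ Finite L ∧ Nonempty (G' ⧸ K ≃* H' ⧸ L)

end

end HypProd

/-! A finite index subgroup `G` of the stabilizer permutes no factors and fixes both boundary
points, so it acts on each factor `X i` by isometries fixing the two ends of a coarse line
(`exists_finiteIndex_fixing`). A coarse Busemann function at one end turns translation along this
line into a quasimorphism. When its value is small, the isometry moves every point near the line
only a little, because points near the line are coarsely determined by their horosphere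
(`IsHyperbolic.exists_quasimorphism`).

Together the factors give a quasimorphism `f : G → ℝ^D`. Elements with `f` bounded coarsely fix two
points of the product that are arbitrarily far apart, so by acylindricity there are finitely many of
them (`exists_proper_quasimorphism`).

The rest is group theory. Commutators have bounded `f`, so there are finitely many and the
commutator subgroup is finite; hence the homogenization of `f` is a homomorphism `F` at bounded
distance from `f`. Its kernel is finite and its image is discrete in `ℝ^D`, hence free abelian of
rank at most `D` (`exists_quotient_mulEquiv_of_quasimorphism`). -/

namespace HypProd

universe u v

/-! ### Coarse Busemann cocycles in a hyperbolic space -/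

section Hyperbolic

variable {X : Type u} [MetricSpace X] {δ : ℝ}

/-- The four-point inequality, in terms of distances. -/
theorem IsHyperbolic.dist_add_dist_le (h : IsHyperbolic δ X) (x y z w : X) :
    dist x z + dist y w ≤ max (dist x y + dist z w) (dist y z + dist x w) + 2 * δ := by
  have h1 := h.four_point x y z w
  have e1 := dist_comm w y
  have e2 := dist_comm w z
  unfold gromovProduct at h1
  rcases min_cases ((dist x w + dist w y - dist x y) / 2)
    ((dist y w + dist w z - dist y z) / 2) with hm | hm
  · have := le_max_left (dist x y + dist z w) (dist y z + dist x w)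
    linarith
  · have := le_max_right (dist x y + dist z w) (dist y z + dist x w)
    linarith

theorem GromovConv.symm {x y : ℕ → X} (h : GromovConv x y) : GromovConv y x := by
  refine gromovConv_iff.2 fun o C => ?_
  obtain ⟨N, hN⟩ := gromovConv_iff.1 h o C
  refine ⟨N, fun n hn m hm => ?_⟩
  rw [gromovProduct_comm]
  exact hN m hm n hn

/-- Half of `IsHyperbolic.abs_busemann_sub_le`. -/
theorem IsHyperbolic.busemann_le (h : IsHyperbolic δ X) {x y : ℕ → X} (hxy : GromovConv x y)
    (a c : X) : ∃ N : ℕ, ∀ n ≥ N, ∀ m ≥ N,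
      dist a (x n) - dist c (x n) ≤ dist a (y m) - dist c (y m) + 2 * δ := by
  -- With this threshold the first term of the maximum in `h2` would contradict the triangle
  -- inequality `h3`; the second term is the claim.
  obtain ⟨N, hN⟩ := gromovConv_iff.1 hxy a (dist a c + δ + 1)
  refine ⟨N, fun n hn m hm => ?_⟩
  have h1 := hN n hn m hm
  have h2 := h.dist_add_dist_le a c (x n) (y m)
  have h3 := dist_triangle a c (y m)
  have e1 := dist_comm (x n) a
  unfold gromovProduct at h1
  rcases max_cases (dist a c + dist (x n) (y m)) (dist c (x n) + dist a (y m)) with hm | hm <;>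
    linarith

/-- Along equivalent Gromov sequences, the differences of the distances to two given points
eventually agree up to `2δ`. -/
theorem IsHyperbolic.abs_busemann_sub_le (h : IsHyperbolic δ X) {x y : ℕ → X}
    (hxy : GromovConv x y) (a c : X) : ∃ N : ℕ, ∀ n ≥ N, ∀ m ≥ N,
      |(dist a (x n) - dist c (x n)) - (dist a (y m) - dist c (y m))| ≤ 2 * δ := by
  obtain ⟨N, hN⟩ := h.busemann_le hxy a c
  obtain ⟨M, hM⟩ := h.busemann_le hxy.symm a c
  refine ⟨max N M, fun n hn m hm => abs_le.2 ?_⟩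
  have h1 := hN n ((le_max_left _ _).trans hn) m ((le_max_left _ _).trans hm)
  have h2 := hM m ((le_max_right _ _).trans hm) n ((le_max_right _ _).trans hn)
  constructor <;> linarith

/-- A bound for Gromov products along two sequences persists, up to `2δ`, along equivalent
sequences. -/
theorem IsHyperbolic.gromovProduct_le_of_frequently (h : IsHyperbolic δ X)
    {x y x' y' : ℕ → X} (hx : GromovConv x x') (hy : GromovConv y y') (o : X) (K : ℝ)
    (hK : ∀ N : ℕ, ∃ n ≥ N, ∃ m ≥ N, gromovProduct (x n) (y m) o ≤ K) :
    ∃ N : ℕ, ∀ n ≥ N, ∀ m ≥ N, gromovProduct (x' n) (y' m) o ≤ K + 2 * δ := by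
  -- One sequence is replaced at a time, at a cost of `δ` each. The thresholds exceed `K + δ` and `K
  -- + 2 * δ`, so the minimum in `h3` and `h4` must be the product to be bounded.
  obtain ⟨N, hN⟩ := gromovConv_iff.1 hx o (K + δ + 1)
  obtain ⟨M, hM⟩ := gromovConv_iff.1 hy o (K + 2 * δ + 1)
  refine ⟨max N M, fun n hn m hm => ?_⟩
  obtain ⟨n', hn', m', hm', hle⟩ := hK (max N M)
  have h1 := hN n' ((le_max_left _ _).trans hn') n ((le_max_left _ _).trans hn)
  have h2 := hM m' ((le_max_right _ _).trans hm') m ((le_max_right _ _).trans hm)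
  have h3 := h.four_point (x n') (x' n) (y m') o
  have h4 := h.four_point (x' n) (y' m) (y m') o
  rw [gromovProduct_comm (y' m) (y m')] at h4
  rcases min_cases (gromovProduct (x n') (x' n) o) (gromovProduct (x' n) (y m') o) with hc | hc <;>
  rcases min_cases (gromovProduct (x' n) (y' m) o) (gromovProduct (y m') (y' m) o) with hd | hd <;>
    linarith

/-- An isometry which fixes the endpoints of two sequences and coarsely preserves the horospheres
at one of them moves points near the line between them by a bounded amount. -/
theorem IsHyperbolic.dist_map_self_le (h : IsHyperbolic δ X) {x y : ℕ → X} {g : X ≃ᵢ X}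
    (hgx : GromovConv (fun n => g (x n)) x) (hgy : GromovConv (fun n => g (y n)) y) {p : X}
    {K B : ℝ} (hK : ∃ N : ℕ, ∀ n ≥ N, ∀ m ≥ N, gromovProduct (x n) (y m) p ≤ K)
    (hB : ∃ N : ℕ, ∀ n ≥ N, |dist (g p) (x n) - dist p (x n)| ≤ B) :
    dist (g p) p ≤ 2 * K + B + 6 * δ := by
  obtain ⟨N₁, h₁⟩ := hK
  obtain ⟨N₂, h₂⟩ := hB
  -- Since `g` carries `p` and the line to `g p` and a line with the same ends, `g p` is also near
  -- the original line.
  obtain ⟨N₃, h₃⟩ := h.gromovProduct_le_of_frequently hgx hgy (g p) K fun N => by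
    refine ⟨max N N₁, le_max_left _ _, max N N₁, le_max_left _ _, ?_⟩
    have := h₁ _ (le_max_right N N₁) _ (le_max_right N N₁)
    unfold gromovProduct at this ⊢
    rwa [g.dist_eq, g.dist_eq, g.dist_eq]
  set n := max N₁ (max N₂ N₃)
  have n1 : N₁ ≤ n := le_max_left _ _
  have n2 : N₂ ≤ n := (le_max_left _ _).trans (le_max_right _ _)
  have n3 : N₃ ≤ n := (le_max_right _ _).trans (le_max_right _ _)
  have k1 := h₁ n n1 n n1
  have k2 := abs_le.1 (h₂ n n2)
  have k3 := h₃ n n3 n n3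
  have k4 := h.dist_add_dist_le (g p) (x n) p (y n)
  have e1 := dist_comm (x n) p
  have e2 := dist_comm (x n) (g p)
  have hδ : 0 ≤ δ := by
    have := h.four_point p p p p
    simp only [min_self] at this
    linarith
  unfold gromovProduct at k1 k3
  rcases max_cases (dist (g p) (x n) + dist p (y n)) (dist (x n) p + dist (g p) (y n))
    with hm | hm <;> linarith

/-- The isometry `g` fixes the boundary point `ξ`. -/
def FixesBoundary (g : X ≃ᵢ X) (ξ : GromovBoundary X) : Prop :=
  GromovBoundary.map g ξ = ξ

/-- The translation length along a line with endpoints `ξ ≠ η` as a quasimorphism on the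
isometries fixing both endpoints: an isometry with small translation length moves all the points
near the line by a small amount. -/
theorem IsHyperbolic.exists_quasimorphism (h : IsHyperbolic δ X) {ξ η : GromovBoundary X}
    (hne : ξ ≠ η) : ∃ (f : (X ≃ᵢ X) → ℝ) (C : ℝ) (o : X),
      (∀ g k : X ≃ᵢ X, FixesBoundary g ξ → |f (g * k) - f g - f k| ≤ C) ∧
      ∀ R : ℝ, ∃ p : X, R ≤ dist o p ∧ ∀ g : X ≃ᵢ X, FixesBoundary g ξ → FixesBoundary g η →
        dist (g o) o ≤ |f g| + C ∧ dist (g p) p ≤ |f g| + C := by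
  obtain ⟨x, rfl⟩ := Quot.exists_rep ξ
  obtain ⟨y, rfl⟩ := Quot.exists_rep η
  have hxy : ¬ GromovConv x.1 y.1 := fun hc => hne ((GromovBoundary.mk_eq_mk_iff h x y).2 hc)
  have hfix : ∀ (g : X ≃ᵢ X) (z : GromovSeq X), FixesBoundary g (Quot.mk _ z) →
      GromovConv (fun n => g (z.1 n)) z.1 := fun g z hz =>
    (GromovBoundary.mk_eq_mk_iff h (z.map g) z).1 hz
  rw [gromovConv_iff] at hxy
  push Not at hxy
  obtain ⟨o, K, hK⟩ := hxy
  have hδ : 0 ≤ δ := by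
    have := h.four_point o o o o
    simp only [min_self] at this
    linarith
  obtain ⟨N₀, hN₀⟩ := h.gromovProduct_le_of_frequently x.2 y.2 o K fun N => by
    obtain ⟨n, hn, m, hm, hlt⟩ := hK N
    exact ⟨n, hn, m, hm, hlt.le⟩
  -- The Busemann difference need not converge; any late value serves as `f g`, up to `2 * δ`.
  have hf : ∀ g : X ≃ᵢ X, ∃ v : ℝ, ∃ N : ℕ, ∀ n ≥ N,
      |dist (g o) (x.1 n) - dist o (x.1 n) - v| ≤ 2 * δ := by
    intro g
    obtain ⟨N, hN⟩ := h.abs_busemann_sub_le x.2 (g o) o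
    exact ⟨_, N, fun n hn => hN n hn N le_rfl⟩
  choose f hf using hf
  -- The shift at `p` agrees coarsely with the shift at `o`, because `g` preserves Busemann
  -- differences at a fixed end up to `2 * δ`.
  have hshift : ∀ (g : X ≃ᵢ X) (p : X), FixesBoundary g (Quot.mk _ x) → ∃ N : ℕ, ∀ n ≥ N,
      |dist (g p) (x.1 n) - dist p (x.1 n)| ≤ |f g| + 4 * δ := by
    intro g p hg
    obtain ⟨N, hN⟩ := hf g
    obtain ⟨M, hM⟩ := h.abs_busemann_sub_le (hfix g x hg) (g p) (g o)
    refine ⟨max N M, fun n hn => abs_le.2 ?_⟩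
    have h1 := abs_le.1 (hN n ((le_max_left _ _).trans hn))
    have h2 := abs_le.1 (hM n ((le_max_right _ _).trans hn) n ((le_max_right _ _).trans hn))
    rw [g.dist_eq, g.dist_eq] at h2
    have h3 := abs_le.1 (le_refl |f g|)
    constructor <;> linarith
  have hmove : ∀ (g : X ≃ᵢ X) (p : X), FixesBoundary g (Quot.mk _ x) →
      FixesBoundary g (Quot.mk _ y) →
      (∃ N : ℕ, ∀ n ≥ N, ∀ m ≥ N, gromovProduct (x.1 n) (y.1 m) p ≤ K + 3 * δ) →
      dist (g p) p ≤ |f g| + (2 * |K| + 16 * δ) := by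
    intro g p hgx hgy hp
    have := h.dist_map_self_le (hfix g x hgx) (hfix g y hgy) hp (hshift g p hgx)
    have := le_abs_self K
    linarith
  refine ⟨f, 2 * |K| + 16 * δ, o, ?_, ?_⟩
  · intro g k hg
    obtain ⟨N₁, h₁⟩ := hf g
    obtain ⟨N₂, h₂⟩ := hf k
    obtain ⟨N₃, h₃⟩ := hf (g * k)
    obtain ⟨N₄, h₄⟩ := h.abs_busemann_sub_le (hfix g x hg) (g (k o)) (g o)
    set n := max (max N₁ N₂) (max N₃ N₄)
    have n1 : N₁ ≤ n := (le_max_left _ _).trans (le_max_left _ _)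
    have n2 : N₂ ≤ n := (le_max_right _ _).trans (le_max_left _ _)
    have n3 : N₃ ≤ n := (le_max_left _ _).trans (le_max_right _ _)
    have n4 : N₄ ≤ n := (le_max_right _ _).trans (le_max_right _ _)
    have k1 := abs_le.1 (h₁ n n1)
    have k2 := abs_le.1 (h₂ n n2)
    have k3 := abs_le.1 (h₃ n n3)
    have k4 := abs_le.1 (h₄ n n4 n n4)
    rw [g.dist_eq, g.dist_eq] at k4
    rw [IsometryEquiv.mul_apply] at k3
    have := abs_nonneg K
    exact abs_le.2 ⟨by linarith, by linarith⟩
  · intro R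
    -- The far point lies at distance `max R 0` from `o` on a geodesic to `x.1 N`. Up to that
    -- distance, geodesics to the later `x.1 n` stay close, so the point is near the line, with `K +
    -- 3 * δ` in place of `K + 2 * δ`.
    obtain ⟨N, hN⟩ := gromovConv_iff.1 x.2 o (max R 0)
    obtain ⟨γ, hγ0, hγ1, hγ⟩ := h.1 o (x.1 N)
    have hR : max R 0 ≤ dist o (x.1 N) :=
      (hN N le_rfl N le_rfl).trans (gromovProduct_le_left _ _ _)
    have e1 := hγ 0 ⟨le_rfl, dist_nonneg⟩ (max R 0) ⟨le_max_right _ _, hR⟩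
    have e2 := hγ (max R 0) ⟨le_max_right _ _, hR⟩ _ ⟨dist_nonneg, le_rfl⟩
    rw [hγ0, zero_sub, abs_neg, abs_of_nonneg (le_max_right _ _)] at e1
    rw [hγ1, abs_of_nonpos (by linarith)] at e2
    refine ⟨γ (max R 0), e1.ge.trans' (le_max_left _ _), fun g hgx hgy =>
      ⟨hmove g o hgx hgy ⟨N₀, fun n hn m hm => (hN₀ n hn m hm).trans (by linarith)⟩,
        hmove g _ hgx hgy ⟨max N N₀, fun n hn m hm => ?_⟩⟩⟩
    have k1 := hN₀ n ((le_max_right _ _).trans hn) m ((le_max_right _ _).trans hm)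
    have k2 := hN N le_rfl n ((le_max_left _ _).trans hn)
    have k3 := h.four_point (γ (max R 0)) (x.1 N) (x.1 n) o
    have k4 : gromovProduct (γ (max R 0)) (x.1 N) o = max R 0 := by
      unfold gromovProduct
      rw [dist_comm _ o, e1, e2]
      ring
    rw [k4, min_eq_left k2] at k3
    have k5 := dist_triangle (γ (max R 0)) o (y.1 m)
    have e3 := dist_comm (γ (max R 0)) o
    have e4 := dist_comm (γ (max R 0)) (x.1 n)
    have e5 := dist_comm (x.1 n) o
    unfold gromovProduct at k1 k3 ⊢
    linarith

end Hyperbolic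

/-! ### Groups with a proper quasimorphism to `ℝ^D` -/

section Quasimorphism

variable {G : Type u} [Group G]

/-- Homogenization of a quasimorphism. -/
theorem exists_tendsto_pow_div {f : G → ℝ} {C : ℝ}
    (hf : ∀ g h, |f (g * h) - f g - f h| ≤ C) (g : G) :
    ∃ v : ℝ, Tendsto (fun n : ℕ => f (g ^ n) / n) atTop (nhds v) ∧ |v - f g| ≤ C := by
  have hC : 0 ≤ C := (abs_nonneg _).trans (hf 1 1)
  have hpow : ∀ n : ℕ, |f (g ^ (n + 1)) - (n + 1 : ℕ) * f g| ≤ (n + 1 : ℕ) * C := by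
    intro n
    induction n with
    | zero => simpa using hC
    | succ n ih =>
      have h1 := abs_le.1 (hf (g ^ (n + 1)) g)
      rw [← pow_succ] at h1
      have h2 := abs_le.1 ih
      push_cast at h2 ⊢
      exact abs_le.2 ⟨by linarith, by linarith⟩
  have hdiv : ∀ n : ℕ, 0 < n → |f (g ^ n) / n - f g| ≤ C := by
    rintro (_ | n) hn
    · exact absurd hn (lt_irrefl 0)
    have hpos : (0 : ℝ) < (n + 1 : ℕ) := by positivity
    have h1 := hpow n
    have : f (g ^ (n + 1)) / (n + 1 : ℕ) - f g
        = (f (g ^ (n + 1)) - (n + 1 : ℕ) * f g) / (n + 1 : ℕ) := by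
      field_simp
    rw [this, abs_div, abs_of_pos hpos, div_le_iff₀ hpos, mul_comm C]
    exact h1
  -- Adding `C` absorbs the defect, so Fekete's lemma gives the limit.
  have hsub : Subadditive fun n : ℕ => f (g ^ n) + C := by
    intro m n
    have := abs_le.1 (hf (g ^ m) (g ^ n))
    rw [← pow_add] at this
    linarith
  have hbdd : BddBelow (Set.range fun n : ℕ => (f (g ^ n) + C) / n) := by
    -- The `0` covers `n = 0`, where division by zero returns `0`.
    refine ⟨min 0 (f g - C), ?_⟩
    rintro _ ⟨n, rfl⟩
    rcases Nat.eq_zero_or_pos n with rfl | hn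
    · simp
    · have h1 := abs_le.1 (hdiv n hn)
      have h2 : 0 ≤ C / (n : ℝ) := by positivity
      refine (min_le_right _ _).trans ?_
      change _ ≤ (f (g ^ n) + C) / n
      rw [add_div]
      linarith
  have hlim : Tendsto (fun n : ℕ => f (g ^ n) / n) atTop (nhds hsub.lim) := by
    have h1 := (hsub.tendsto_lim hbdd).sub (tendsto_const_div_atTop_nhds_zero_nat C)
    rw [sub_zero] at h1
    refine h1.congr fun n => ?_
    rw [add_div, add_sub_cancel_right]
  refine ⟨hsub.lim, hlim, ?_⟩
  exact le_of_tendsto (hlim.sub_const _).abs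
    ((eventually_gt_atTop 0).mono fun n hn => hdiv n hn)

/-- If a group has a quasimorphism to `ℝ^D` with finite sublevel sets, then its commutator
subgroup is finite. -/
theorem finite_commutator_of_quasimorphism {ι : Type v} {f : G → ι → ℝ} {C : ℝ}
    (hf : ∀ g h i, |f (g * h) i - f g i - f h i| ≤ C)
    (hfin : ∀ B : ℝ, {g : G | ∀ i, |f g i| ≤ B}.Finite) : Finite (commutator G) := by
  have : Finite (commutatorSet G) := by
    refine ((hfin (5 * C)).subset ?_).to_subtype
    rintro _ ⟨g, h, rfl⟩ i
    have h1 := abs_le.1 (hf (g * h * g⁻¹ * h⁻¹) (h * g) i)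
    rw [show g * h * g⁻¹ * h⁻¹ * (h * g) = g * h by group] at h1
    have h2 := abs_le.1 (hf h g i)
    have h3 := abs_le.1 (hf g h i)
    rw [commutatorElement_def]
    exact abs_le.2 ⟨by linarith, by linarith⟩
  -- A group with finitely many commutators has a finite commutator subgroup.
  infer_instance

/-- A quasimorphism to `ℝ^D` on a group with finite commutator subgroup is at bounded distance
from a homomorphism. -/
theorem exists_monoidHom_near_quasimorphism {ι : Type v} [Finite (commutator G)] {f : G → ι → ℝ}
    {C : ℝ} (hf : ∀ g h i, |f (g * h) i - f g i - f h i| ≤ C) :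
    ∃ F : G →* Multiplicative (ι → ℝ), ∀ g i, |(F g).toAdd i - f g i| ≤ C := by
  choose F hF hFC using fun (g : G) (i : ι) =>
    exists_tendsto_pow_div (f := fun g => f g i) (fun g h => hf g h i) g
  refine ⟨MonoidHom.mk' (fun g => Multiplicative.ofAdd (F g)) fun g h => ?_, hFC⟩
  rw [← ofAdd_add]
  congr 1
  funext i
  obtain ⟨B, hB⟩ := (Set.toFinite (Set.range fun c : commutator G => |f c i|)).bddAbove
  -- The two powers agree in the abelianization, and `f` is bounded on the finite commutator
  -- subgroup, so the discrepancy vanishes after division by `n`.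
  have hcomm : ∀ n : ℕ, ∃ c : commutator G, (g * h) ^ n = g ^ n * h ^ n * c := by
    intro n
    refine ⟨⟨(g ^ n * h ^ n)⁻¹ * (g * h) ^ n, ?_⟩, (mul_inv_cancel_left _ _).symm⟩
    have : (Abelianization.of ((g ^ n * h ^ n)⁻¹ * (g * h) ^ n)) = 1 := by
      simp only [map_mul, map_inv, map_pow, mul_pow, inv_mul_cancel]
    rwa [← MonoidHom.mem_ker, Abelianization.ker_of] at this
  have hbound : ∀ n : ℕ, |f ((g * h) ^ n) i - (f (g ^ n) i + f (h ^ n) i)| ≤ B + 2 * C := by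
    intro n
    obtain ⟨c, hc⟩ := hcomm n
    have h1 := abs_le.1 (hf (g ^ n * h ^ n) c i)
    have h2 := abs_le.1 (hf (g ^ n) (h ^ n) i)
    have h3 := abs_le.1 (hB ⟨c, rfl⟩)
    rw [hc]
    exact abs_le.2 ⟨by linarith, by linarith⟩
  have hlim := (hF (g * h) i).sub ((hF g i).add (hF h i))
  have hzero : Tendsto (fun n : ℕ => f ((g * h) ^ n) i / n - (f (g ^ n) i / n + f (h ^ n) i / n))
      atTop (nhds 0) := by
    refine squeeze_zero_norm (fun n => ?_) (tendsto_const_div_atTop_nhds_zero_nat (B + 2 * C))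
    rw [← add_div, ← sub_div, Real.norm_eq_abs, abs_div, Nat.abs_cast]
    exact div_le_div_of_nonneg_right (hbound n) (Nat.cast_nonneg n)
  exact sub_eq_zero.1 (tendsto_nhds_unique hlim hzero)

/-- A subgroup of `ℝ^D` with finitely many elements in the unit ball is free abelian of rank at
most `D`. -/
theorem exists_linearEquiv_of_finite_inter_ball {D : ℕ} (L : Submodule ℤ (Fin D → ℝ))
    (hL : ((L : Set (Fin D → ℝ)) ∩ Metric.ball 0 1).Finite) :
    ∃ k ≤ D, Nonempty (L ≃ₗ[ℤ] (Fin k → ℤ)) := by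
  have hd : DiscreteTopology L := by
    refine discreteTopology_of_isOpen_singleton_zero ?_
    refine isOpen_induced_iff.2
      ⟨Metric.ball 0 1 \ (((L : Set (Fin D → ℝ)) ∩ Metric.ball 0 1) \ {0}),
        Metric.isOpen_ball.sdiff (hL.subset Set.sdiff_subset).isClosed, ?_⟩
    ext ⟨z, hz⟩
    simp only [Set.mem_preimage, Set.mem_sdiff, Set.mem_inter_iff, SetLike.mem_coe, hz, true_and,
      Set.mem_singleton_iff, Submodule.mk_eq_zero, not_and, not_not]
    constructor
    · rintro ⟨h1, h2⟩
      exact h2 h1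
    · rintro rfl
      exact ⟨Metric.mem_ball_self one_pos, fun _ => rfl⟩
  -- For a discrete subgroup the `ℤ`-rank is the dimension of the real span, hence at most `D`.
  have hrank := Real.finrank_eq_int_finrank_of_discrete (s := (L : Set (Fin D → ℝ)))
    (by rwa [Submodule.span_eq])
  have hle : Set.finrank ℝ (L : Set (Fin D → ℝ)) ≤ D := by
    simpa [Set.finrank] using Submodule.finrank_le (Submodule.span ℝ (L : Set (Fin D → ℝ)))
  rw [hrank, Set.finrank, Submodule.span_eq] at hle
  exact ⟨_, hle, ⟨(Module.finBasis ℤ L).equivFun⟩⟩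

/-- A group with a quasimorphism to `ℝ^D` with finite sublevel sets is finite-by-`ℤ^k` for some
`k ≤ D`. -/
theorem exists_quotient_mulEquiv_of_quasimorphism {D : ℕ} {f : G → Fin D → ℝ} {C : ℝ}
    (hf : ∀ g h i, |f (g * h) i - f g i - f h i| ≤ C)
    (hfin : ∀ B : ℝ, {g : G | ∀ i, |f g i| ≤ B}.Finite) :
    ∃ k ≤ D, ∃ (K : Subgroup G) (_ : K.Normal), Finite K ∧
      Nonempty (G ⧸ K ≃* Multiplicative (Fin k → ℤ)) := by
  have := finite_commutator_of_quasimorphism hf hfin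
  obtain ⟨F, hF⟩ := exists_monoidHom_near_quasimorphism hf
  -- This gives both the discreteness of the image and the finiteness of the kernel.
  have hball : {g : G | (F g).toAdd ∈ Metric.ball (0 : Fin D → ℝ) 1}.Finite := by
    refine (hfin (1 + C)).subset fun g hg i => ?_
    have h1 : |(F g).toAdd i| ≤ 1 := (norm_le_pi_norm (F g).toAdd i).trans
      (mem_ball_zero_iff.1 hg).le
    have h2 := abs_le.1 (hF g i)
    have h3 := abs_le.1 h1
    exact abs_le.2 ⟨by linarith, by linarith⟩
  let L : AddSubgroup (Fin D → ℝ) := Subgroup.toAddSubgroup' F.range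
  obtain ⟨k, hk, ⟨e⟩⟩ := exists_linearEquiv_of_finite_inter_ball (AddSubgroup.toIntSubmodule L) (by
    refine (hball.image fun g => (F g).toAdd).subset ?_
    rintro z ⟨⟨g, hg⟩, hz⟩
    exact ⟨g, by rw [Set.mem_ofPred_eq, hg]; exact hz, congrArg Multiplicative.toAdd hg⟩)
  refine ⟨k, hk, F.ker, inferInstance, ?_, ⟨(QuotientGroup.quotientKerEquivRange F).trans ?_⟩⟩
  · refine (hball.subset fun g hg => ?_).to_subtype
    have hg' : F g = 1 := hg
    rw [Set.mem_ofPred_eq, hg', toAdd_one]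
    exact Metric.mem_ball_self one_pos
  · exact
      { toFun := fun z => Multiplicative.ofAdd (e ⟨z.1.toAdd, z.2⟩)
        invFun := fun w => ⟨Multiplicative.ofAdd (e.symm w.toAdd).1, (e.symm w.toAdd).2⟩
        left_inv := fun z => by simp
        right_inv := fun w => by simp
        map_mul' := fun z w => congrArg Multiplicative.ofAdd
          (e.map_add ⟨z.1.toAdd, z.2⟩ ⟨w.1.toAdd, w.2⟩) }

end Quasimorphism

/-! ### Automorphisms preserving the factors -/

namespace ProdAut

variable {D : ℕ} {X : Fin D → Type u} [∀ i, MetricSpace (X i)]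

/-- The isometry of the factor `X j` given by an automorphism which does not permute factors. -/
noncomputable def factor (g : ProdAut X) (hg : g.perm = 1) (j : Fin D) : X j ≃ᵢ X j :=
  (castIso X (by rw [hg]; rfl : j = g.perm j)).trans (g.iso j)

theorem smul_apply_eq_factor (g : ProdAut X) (hg : g.perm = 1) (z : ∀ i, X i) (j : Fin D) :
    (g • z) j = g.factor hg j (z j) := by
  obtain ⟨σ, φ⟩ := g
  obtain rfl : σ = 1 := hg
  rfl

theorem factor_mul (g h : ProdAut X) (hg : g.perm = 1) (hh : h.perm = 1)
    (hgh : (g * h).perm = 1) (j : Fin D) :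
    (g * h).factor hgh j = g.factor hg j * h.factor hh j := by
  obtain ⟨σ, φ⟩ := g
  obtain rfl : σ = 1 := hg
  obtain ⟨τ, ψ⟩ := h
  obtain rfl : τ = 1 := hh
  rfl

theorem fixesBoundary_factor {g : ProdAut X} (hg : g.perm = 1) {ξ : RegBoundary X}
    (hξ : g • ξ = ξ) (j : Fin D) : FixesBoundary (g.factor hg j) (ξ j) := by
  have h1 : GromovBoundary.map (g.factor hg j) (ξ j) = (g • ξ) j := by
    obtain ⟨σ, φ⟩ := g
    obtain rfl : σ = 1 := hg
    rfl
  exact h1.trans (congrFun hξ j)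

/-- The permutation of the factors, as a homomorphism. -/
def permHom (X : Fin D → Type u) [∀ i, MetricSpace (X i)] : ProdAut X →* Equiv.Perm (Fin D) where
  -- Products in `ProdAut X` compose permutations in reverse order; the inverse corrects this.
  toFun g := g.perm⁻¹
  map_one' := inv_one
  map_mul' g h := mul_inv_rev h.perm g.perm

theorem mem_ker_permHom {g : ProdAut X} : g ∈ (permHom X).ker ↔ g.perm = 1 :=
  inv_eq_one

end ProdAut

/-! ### Passage to finite index and properness of the quasimorphism -/

/-- A point of an invariant finite set has a stabilizer of finite index. -/
theorem finiteIndex_stabilizer_of_finite {G : Type u} {Y : Type v} [Group G] [MulAction G Y]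
    {S : Set Y} (hS : S.Finite) {y : Y} (hy : ∀ g : G, g • y ∈ S) :
    (MulAction.stabilizer G y).FiniteIndex := by
  have hfin : (MulAction.orbit G y).Finite := hS.subset (by rintro _ ⟨g, rfl⟩; exact hy g)
  refine ⟨?_⟩
  rw [MulAction.index_stabilizer]
  exact Nat.pos_iff_ne_zero.1 ((Set.ncard_pos hfin).2 (MulAction.nonempty_orbit y))

/-- The stabilizer of a pair of points has a subgroup of finite index fixing both points and
preserving all the factors. -/
theorem exists_finiteIndex_fixing {D : ℕ} {X : Fin D → Type u} [∀ i, MetricSpace (X i)]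
    {Γ : Type v} [Group Γ] (ρ : Γ →* ProdAut X) (ξ η : RegBoundary X) :
    ∃ H : Subgroup ((MulAction.stabilizer (ProdAut X) ({ξ, η} : Set (RegBoundary X))).comap ρ),
      H.FiniteIndex ∧ ∀ g ∈ H, (ρ g).perm = 1 ∧ ρ g • ξ = ξ ∧ ρ g • η = η := by
  let E := (MulAction.stabilizer (ProdAut X) ({ξ, η} : Set (RegBoundary X))).comap ρ
  let φ : E →* ProdAut X := ρ.comp E.subtype
  let _ : MulAction E (RegBoundary X) := MulAction.compHom _ φ
  have hmaps : ∀ (g : E), ∀ ζ ∈ ({ξ, η} : Set (RegBoundary X)),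
      g • ζ ∈ ({ξ, η} : Set (RegBoundary X)) := by
    intro g ζ hζ
    have hg : ρ g.1 • ({ξ, η} : Set (RegBoundary X)) = {ξ, η} := g.2
    rw [← hg]
    exact Set.smul_mem_smul_set hζ
  have h1 : (MulAction.stabilizer E ξ).FiniteIndex :=
    finiteIndex_stabilizer_of_finite (Set.toFinite {ξ, η}) fun g => hmaps g ξ (by simp)
  have h2 : (MulAction.stabilizer E η).FiniteIndex :=
    finiteIndex_stabilizer_of_finite (Set.toFinite {ξ, η}) fun g => hmaps g η (by simp)
  have h3 : ((ProdAut.permHom X).comp φ).ker.FiniteIndex := Subgroup.finiteIndex_ker _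
  exact ⟨((ProdAut.permHom X).comp φ).ker ⊓ (MulAction.stabilizer E ξ ⊓ MulAction.stabilizer E η),
    inferInstance, fun g hg => ⟨ProdAut.mem_ker_permHom.1 hg.1, hg.2.1, hg.2.2⟩⟩

/-- A group acting AU-acylindrically on a product of hyperbolic spaces, preserving the factors and
fixing two regular boundary points with distinct factors, has a quasimorphism to `ℝ^D` with finite
sublevel sets. -/
theorem exists_proper_quasimorphism {D : ℕ} (hD : 1 ≤ D) {X : Fin D → Type u}
    [∀ i, MetricSpace (X i)] {δ : ℝ} (hX : ∀ i, IsHyperbolic δ (X i)) {Γ : Type v} [Group Γ]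
    {ρ : Γ →* ProdAut X} (hρ : IsAUAcylindrical ((toIsom (ProdAut X) (∀ i, X i)).comp ρ))
    {ξ η : RegBoundary X} (hξη : ∀ i, ξ i ≠ η i) {G : Type v} [Group G] {φ : G →* Γ}
    (hφ : Function.Injective φ)
    (hfix : ∀ g, (ρ (φ g)).perm = 1 ∧ ρ (φ g) • ξ = ξ ∧ ρ (φ g) • η = η) :
    ∃ (f : G → Fin D → ℝ) (C : ℝ), (∀ g h i, |f (g * h) i - f g i - f h i| ≤ C) ∧
      ∀ B : ℝ, {g : G | ∀ i, |f g i| ≤ B}.Finite := by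
  choose f C o hf hp using fun i => (hX i).exists_quasimorphism (hξη i)
  obtain ⟨C', hC'⟩ := (Set.toFinite (Set.range C)).bddAbove
  have hC : ∀ i, C i ≤ C' := fun i => hC' ⟨i, rfl⟩
  let a : G → ∀ i, X i ≃ᵢ X i := fun g => (ρ (φ g)).factor (hfix g).1
  have ha : ∀ g i, FixesBoundary (a g i) (ξ i) ∧ FixesBoundary (a g i) (η i) := fun g i =>
    ⟨ProdAut.fixesBoundary_factor _ (hfix g).2.1 i, ProdAut.fixesBoundary_factor _ (hfix g).2.2 i⟩
  refine ⟨fun g i => f i (a g i), C', fun g h i => ?_, fun B => ?_⟩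
  · have hmul : a (g * h) i = a g i * a h i := by
      have hgh := (hfix (g * h)).1
      have e : ρ (φ (g * h)) = ρ (φ g) * ρ (φ h) := by rw [map_mul, map_mul]
      rw [← ProdAut.factor_mul _ _ (hfix g).1 (hfix h).1 (e ▸ hgh)]
      simp only [a, e]
    beta_reduce
    rw [hmul]
    exact (hf i _ _ (ha g i).1).trans (hC i)
  -- `B + C'` bounds the displacement in every factor; the maximum with `1` only ensures positivity.
  · obtain ⟨R, -, hR⟩ := hρ (max (B + C') 1) (lt_max_of_lt_right one_pos)
    choose p hop hmove using fun i => hp i R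
    -- In the `ℓ^∞` metric one factor suffices, and `1 ≤ D` provides it.
    have hdist : R ≤ dist o p := (hop ⟨0, hD⟩).trans (dist_le_pi_dist o p _)
    refine Set.Finite.of_injOn (f := φ) (fun g hg => ?_) hφ.injOn (hR o p hdist)
    have hle : ∀ i, |f i (a g i)| + C i ≤ max (B + C') 1 := fun i =>
      (add_le_add (hg i) (hC i)).trans (le_max_left _ _)
    have hnn : 0 ≤ max (B + C') 1 := zero_le_one.trans (le_max_right _ _)
    rintro z (rfl | rfl)
    · refine (dist_pi_le_iff hnn).2 fun i => ?_
      have := ((hmove i _ (ha g i).1 (ha g i).2).1).trans (hle i)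
      rwa [← ProdAut.smul_apply_eq_factor] at this
    · refine (dist_pi_le_iff hnn).2 fun i => ?_
      have := ((hmove i _ (ha g i).1 (ha g i).2).2).trans (hle i)
      rwa [← ProdAut.smul_apply_eq_factor] at this

end HypProd


/-- For an AU-acylindrical action of `Γ` on a product `𝕏` of `D ≥ 1` geodesic `δ`-hyperbolic
spaces and two regular boundary points with distinct factors, the stabilizer in `Γ` of the pair
is virtually isomorphic to `ℤ^k` for some `0 ≤ k ≤ D`. -/
theorem mainTheorem4 {D : ℕ} (hD : 1 ≤ D) (X : Fin D → Type*)
    [∀ i, MetricSpace (X i)] (δ : ℝ) (hX : ∀ i, HypProd.IsHyperbolic δ (X i))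
    (Γ : Type*) [Group Γ] (ρ : Γ →* HypProd.ProdAut X)
    (hρ : HypProd.IsAUAcylindrical ((HypProd.toIsom (HypProd.ProdAut X) (∀ i, X i)).comp ρ))
    (ξm ξp : HypProd.RegBoundary X) (hξ : ∀ i, ξm i ≠ ξp i) :
    ∃ k : ℕ, k ≤ D ∧
      HypProd.VirtuallyIsomorphic
        ((MulAction.stabilizer (HypProd.ProdAut X)
          ({ξm, ξp} : Set (HypProd.RegBoundary X))).comap ρ)
        (Multiplicative (Fin k → ℤ)) := by

  obtain ⟨H, hH, hfix⟩ := HypProd.exists_finiteIndex_fixing ρ ξm ξp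
  obtain ⟨f, C, hf, hfin⟩ := HypProd.exists_proper_quasimorphism hD hX hρ hξ
    (φ := (Subgroup.subtype _).comp H.subtype)
    (Subtype.val_injective.comp Subtype.val_injective) fun g => hfix g.1 g.2
  obtain ⟨k, hk, K, hK, hKfin, ⟨e⟩⟩ := HypProd.exists_quotient_mulEquiv_of_quasimorphism hf hfin
  exact ⟨k, hk, H, ⊤, hH, inferInstance, K, ⊥, hK, inferInstance, hKfin, inferInstance,
    ⟨e.trans (QuotientGroup.quotientBot.trans Subgroup.topEquiv).symm⟩⟩
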